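/- Let $q$ be a power of a prime $p$, let $m\ge 1$, let $(P_1,\dots,P_n)$ be an enumeration of the points of $\mathbf{F}_q^m$ with $n=q^m$, and for $0\le\nu\le m(q-1)-1$ let $$\mathcal{R}_q(\nu,m)=\{(f(P_1),\dots,f(P_n)) : f\in\mathbf{F}_q[x_1,\dots,x_m],\ \deg f\le\nu\}$$ be the generalized Reed--Muller code of order $\nu$. Put $$k(\nu)=\sum_{j=0}^m(-1)^j\binom{m}{j}\binom{m+\nu-jq}{\nu-jq},\qquad d(\nu)=(R+1)q^{Q},$$ where $m(q-1)-\nu=(q-1)Q+R$ with $0\le R<q-1$, binomial coefficients with negative lower entry are zero, and $\nu^\perp=m(q-1)-1-\nu$. Let $0\le\nu_1\le\nu_2\le m(q-1)-1$. Then $\mathcal{R}_q(\nu_1,m)\subseteq\mathcal{R}_q(\nu_2,m)$; these codes have dimensions $k(\nu_1)$ and $k(\nu_2)$; $\mathcal{R}_q(\nu_2,m)$ has minimum distance $d(\nu_2)$ and the Euclidean dual code $\mathcal{R}_q(\nu_1,m)^\perp$ has minimum distance $d(\nu_1^\perp)$; if $\nu_1<\nu_2$, then $\mathcal{R}_q(\nu_2,m)\setminus\mathcal{R}_q(\nu_1,m)$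 contains a word of weight $d(\nu_2)$. Moreover, there exists a pure $$[[q^m,\ k(\nu_2)-k(\nu_1),\ \min\{d(\nu_1^\perp),d(\nu_2)\}]]_q$$ quantum stabilizer code, namely the one given by the CSS construction from $\mathcal{R}_q(\nu_1,m)\subseteq\mathcal{R}_q(\nu_2,m)$. Here $X(a)|x\rangle=|x+a\rangle$ and $Z(b)|x\rangle=\omega^{\mathrm{tr}(b\cdot x)}|x\rangle$ for $a,b,x\in\mathbf{F}_q^n$, with $\omega=e^{2\pi i/p}$ and $\mathrm{tr}$ the trace from $\mathbf{F}_q$ to $\mathbf{F}_p$; a stabilizer code is a nonzero joint $+1$-eigenspace in $(\mathbf{C}^q)^{\otimes n}$ of a subgroup $S$ of the group generated by all $X(a)Z(b)$; the CSS construction from $C_1\subseteq C_2$ takes $S=\{X(a)Z(b): a\in C_1,\ b\in C_2^\perp\}$. The weight of $cX(a)Z(b)$ is the number of $i$ with $(a_i,b_i)\ne(0,0)$. An $[[n,k,d]]_q$ code has dimension $q^k$ and minimum distance $d$: if $k>0$, it detects all errors $X(a)Z(b)$ of weight less than $d$ but not all of weight $d$; if $k=0$, $d$ is the least weight of a non-scalar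 element of $S$. The code is pure if $S$ contains no non-scalar element of weight less than $d$. -/

import Mathlib

open Matrix

noncomputable section

/-! ### Classical codes -/

/-- The Euclidean dual of a linear code `C ⊆ F^n`. -/
def dualCode {F : Type*} [Field F] {n : ℕ} (C : Submodule F (Fin n → F)) :
    Submodule F (Fin n → F) where
  carrier := {y | ∀ x ∈ C, x ⬝ᵥ y = 0}
  zero_mem' := fun x _ => dotProduct_zero x
  add_mem' := fun {y z} hy hz x hx => by rw [dotProduct_add, hy x hx, hz x hx, add_zero]
  smul_mem' := fun c y hy x hx => by rw [dotProduct_smul, hy x hx, smul_zero]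

/-- `d` is the minimum (Hamming) distance of the linear code `C`. -/
def IsMinDistance {F : Type*} [Field F] [DecidableEq F] {n : ℕ}
    (C : Submodule F (Fin n → F)) (d : ℕ) : Prop :=
  (∀ c ∈ C, c ≠ 0 → d ≤ hammingNorm c) ∧ ∃ c ∈ C, c ≠ 0 ∧ hammingNorm c = d

/-- The evaluation map `f ↦ (f(P₁), …, f(Pₙ))` on polynomials in `m` variables. -/
def evalPoints {F : Type*} [Field F] {n m : ℕ} (P : Fin n → (Fin m → F)) :
    MvPolynomial (Fin m) F →ₗ[F] (Fin n → F) :=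
  LinearMap.pi fun i => (MvPolynomial.aeval (P i)).toLinearMap

/-- The generalized Reed-Muller code of order `ν`: evaluations of all polynomials of total
degree at most `ν` at the points enumerated by `P`. -/
def grmCode {F : Type*} [Field F] {n m : ℕ} (P : Fin n ≃ (Fin m → F)) (ν : ℕ) :
    Submodule F (Fin n → F) :=
  (MvPolynomial.restrictTotalDegree (Fin m) F ν).map (evalPoints P)

/-- `k(ν) = ∑_{j=0}^m (-1)^j binom(m,j) binom(m+ν-jq, ν-jq)`, where a binomial coefficient
with negative lower entry is zero. -/
def grmDim (q m ν : ℕ) : ℤ :=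
  ∑ j ∈ Finset.range (m + 1),
    if j * q ≤ ν then
      (-1 : ℤ) ^ j * (m.choose j : ℤ) * ((m + (ν - j * q)).choose (ν - j * q) : ℤ)
    else 0

/-- `d(ν) = (R+1) q^Q`, where `m(q-1) - ν = (q-1) Q + R` with `0 ≤ R < q-1`
(used for `q ≥ 2` and `ν ≤ m(q-1)`). -/
def grmDist (q m ν : ℕ) : ℕ :=
  ((m * (q - 1) - ν) % (q - 1) + 1) * q ^ ((m * (q - 1) - ν) / (q - 1))

/-- The dual order `ν^⊥ = m(q-1) - 1 - ν` (used for `ν ≤ m(q-1) - 1`). -/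
def dualOrder (q m ν : ℕ) : ℕ := m * (q - 1) - 1 - ν

/-! ### Quantum stabilizer codes

The state space `(ℂ^q)^{⊗ n}` is the space of functions `(Fin n → F) → ℂ`; the function which
is `1` at `x` and `0` elsewhere is the basis state `|x₁⟩ ⊗ ⋯ ⊗ |xₙ⟩`. -/

section Quantum

variable {F : Type*} [Field F] [Fintype F] [DecidableEq F] {n : ℕ}

/-- The shift operator `X(a) = X(a₁) ⊗ ⋯ ⊗ X(aₙ)`, `X(a)|x⟩ = |x + a⟩`. -/
def opX (a : Fin n → F) : Matrix (Fin n → F) (Fin n → F) ℂ :=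
  Matrix.of fun y x => if y = x + a then 1 else 0

/-- The phase operator `Z(b) = Z(b₁) ⊗ ⋯ ⊗ Z(bₙ)`, `Z(b)|x⟩ = ω^{tr(b · x)}|x⟩`, with
`ω = exp(2πi/p)` and `tr` the trace from `F` to its prime field. -/
def opZ (p : ℕ) [Fact p.Prime] [Algebra (ZMod p) F] (b : Fin n → F) :
    Matrix (Fin n → F) (Fin n → F) ℂ :=
  Matrix.diagonal fun x => ZMod.stdAddChar (Algebra.trace (ZMod p) F (b ⬝ᵥ x))

/-- The error operator `X(a) Z(b)`. -/
def opE (p : ℕ) [Fact p.Prime] [Algebra (ZMod p) F] (a b : Fin n → F) :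
    Matrix (Fin n → F) (Fin n → F) ℂ :=
  opX a * opZ p b

/-- The weight of the operators `c X(a) Z(b)`: the number of tensor factors that are not a
multiple of the identity. -/
def errorWeight (a b : Fin n → F) : ℕ :=
  (Finset.univ.filter fun i => a i ≠ 0 ∨ b i ≠ 0).card

/-- The error group, generated by the operators `X(a) Z(b)`; it consists of all
`ω^c X(a) Z(b)`. -/
def errorGroup (F : Type*) [Field F] [Fintype F] [DecidableEq F] (n p : ℕ) [Fact p.Prime]
    [Algebra (ZMod p) F] : Subgroup (Matrix (Fin n → F) (Fin n → F) ℂ)ˣ :=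
  Subgroup.closure {g | ∃ a b : Fin n → F, (g : Matrix (Fin n → F) (Fin n → F) ℂ) = opE p a b}

/-- `Q` is the stabilizer code with stabilizer group `S`: a nonzero subspace which is the joint
`+1`-eigenspace of a subgroup `S` of the error group. -/
structure IsStabilizerCode (p : ℕ) [Fact p.Prime] [Algebra (ZMod p) F]
    (S : Subgroup (Matrix (Fin n → F) (Fin n → F) ℂ)ˣ)
    (Q : Submodule ℂ ((Fin n → F) → ℂ)) : Prop where
  le_errorGroup : S ≤ errorGroup F n p
  mem_iff : ∀ v, v ∈ Q ↔
    ∀ g ∈ S, (g : Matrix (Fin n → F) (Fin n → F) ℂ) *ᵥ v = v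
  ne_bot : Q ≠ ⊥

/-- The code `Q` detects the error `E`: there is a scalar `l` with `⟨u|E|v⟩ = l ⟨u|v⟩` for all
`u`, `v` in `Q`. -/
def Detects (Q : Submodule ℂ ((Fin n → F) → ℂ))
    (E : Matrix (Fin n → F) (Fin n → F) ℂ) : Prop :=
  ∃ l : ℂ, ∀ u ∈ Q, ∀ v ∈ Q, star u ⬝ᵥ (E *ᵥ v) = l * (star u ⬝ᵥ v)

/-- The stabilizer group `S` contains an element `c X(a) Z(b)`, up to the scalar `c`. -/
def ContainsError (p : ℕ) [Fact p.Prime] [Algebra (ZMod p) F]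
    (S : Subgroup (Matrix (Fin n → F) (Fin n → F) ℂ)ˣ) (a b : Fin n → F) : Prop :=
  ∃ g ∈ S, ∃ c : ℂ, (g : Matrix (Fin n → F) (Fin n → F) ℂ) = c • opE p a b

/-- A stabilizer code is pure to `t` if its stabilizer group contains no non-scalar operator of
weight less than `t`. -/
def IsPureTo (p : ℕ) [Fact p.Prime] [Algebra (ZMod p) F]
    (S : Subgroup (Matrix (Fin n → F) (Fin n → F) ℂ)ˣ) (t : ℕ) : Prop :=
  ∀ a b : Fin n → F, 0 < errorWeight a b → errorWeight a b < t → ¬ ContainsError p S a b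

/-- `d` is the minimum distance of the stabilizer code `Q` with stabilizer group `S`. If
`dim Q > 1`: all errors of weight less than `d` are detected, and some error of weight `d` is
not. If `dim Q = 1`, where every error is detected, the usual convention applies: `d` is the
least weight of a non-scalar element of the stabilizer group. -/
def IsQuantumDistance (p : ℕ) [Fact p.Prime] [Algebra (ZMod p) F]
    (S : Subgroup (Matrix (Fin n → F) (Fin n → F) ℂ)ˣ)
    (Q : Submodule ℂ ((Fin n → F) → ℂ)) (d : ℕ) : Prop :=
  (1 < Module.finrank ℂ Q →
    (∀ a b : Fin n → F, errorWeight a b < d → Detects Q (opE p a b)) ∧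
    ∃ a b : Fin n → F, errorWeight a b = d ∧ ¬ Detects Q (opE p a b)) ∧
  (Module.finrank ℂ Q = 1 →
    IsPureTo p S d ∧
    ∃ a b : Fin n → F, 0 < errorWeight a b ∧ errorWeight a b = d ∧ ContainsError p S a b)

/-- `Q` is a pure `[[n, k, d]]_q` stabilizer code with stabilizer group `S`, where `q = |F|`:
its dimension is `q^k`, its minimum distance is `d`, and it is pure to `d`. -/
structure IsPureStabilizerCode (p : ℕ) [Fact p.Prime] [Algebra (ZMod p) F]
    (S : Subgroup (Matrix (Fin n → F) (Fin n → F) ℂ)ˣ)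
    (Q : Submodule ℂ ((Fin n → F) → ℂ)) (k d : ℕ) : Prop where
  isStabilizerCode : IsStabilizerCode p S Q
  finrank_eq : Module.finrank ℂ Q = Fintype.card F ^ k
  distance : IsQuantumDistance p S Q d
  pure : IsPureTo p S d

/-- The stabilizer group of the CSS construction from `C₁ ⊆ C₂`: it is generated by (and, for
`C₁ ⊆ C₂`, consists of) the operators `X(a) Z(b)` with `a ∈ C₁` and `b ∈ C₂^⊥`. -/
def cssStabilizer (p : ℕ) [Fact p.Prime] [Algebra (ZMod p) F]
    (C₁ C₂ : Submodule F (Fin n → F)) :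
    Subgroup (Matrix (Fin n → F) (Fin n → F) ℂ)ˣ :=
  Subgroup.closure {g | ∃ a ∈ C₁, ∃ b ∈ dualCode C₂,
    (g : Matrix (Fin n → F) (Fin n → F) ℂ) = opE p a b}

end Quantum

end

/-! The words of a generalized Reed-Muller code of order `ν` are the evaluations of the reduced
polynomials (degree at most `q - 1` in each variable) of total degree at most `ν`, because
`x ^ q = x` on `F`. A nonzero reduced polynomial of degree at most `ν` does not vanish in at least
`d(ν)` points, by induction on the number of variables
(`codegreeDist_le_card_eval_ne_zero`), and products of linear factors `xᵢ - β` attain this bound.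
In particular evaluation is injective on reduced polynomials, so that the dimension is the number
of reduced monomials of degree at most `ν`; the generating function
`(1 - X ^ q) ^ m / (1 - X) ^ (m + 1)` shows that it equals `k(ν)` (`card_reducedExponents`).

A polynomial of degree less than `m (q - 1)` has sum zero over `F ^ m`, so the code of order
`m (q - 1) - 1 - ν` is contained in the dual of the code of order `ν`; the two have the same
dimension because `e ↦ q - 1 - e` is an involution of the reduced exponents (`dualCode_grmCode`).
Since `d` is strictly decreasing, a word of minimum weight is in no code of smaller order.

For the quantum code, the joint `+1`-eigenspace of the CSS stabilizer group of `C₁ ⊆ C₂` consists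
of the functions supported on `C₂` and constant on the cosets of `C₁`, that is, of the functions
on `C₂ / C₁`. An error `X(a) Z(b)` with `a ∉ C₂` moves the support away, and one with `b ∉ C₁^⊥`
averages to zero over a coset of `C₁`; both are detected. An error of weight less than the minimum
distances of `C₂` and `C₁^⊥` is of one of these kinds or trivial. Conversely `X(a)` with
`a ∈ C₂ \ C₁` and `Z(b)` with `b ∈ C₁^⊥ \ C₂^⊥` are not detected, as their action on the
indicator functions of the cosets of `C₁` shows (`isPureStabilizerCode_cssCode`). -/

/-! ### The function `(R + 1) q ^ Q` -/

/-- `(R + 1) q ^ Q`, where `s = (q - 1) Q + R` with `0 ≤ R < q - 1`. For the codegree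
`s = m (q - 1) - ν`, this is the distance `d(ν)`. -/
def codegreeDist (q s : ℕ) : ℕ := (s % (q - 1) + 1) * q ^ (s / (q - 1))

lemma codegreeDist_of_lt {q s : ℕ} (h : s < q - 1) : codegreeDist q s = s + 1 := by
  simp [codegreeDist, Nat.mod_eq_of_lt h, Nat.div_eq_of_lt h]

lemma codegreeDist_add {q : ℕ} (hq : 2 ≤ q) (s : ℕ) :
    codegreeDist q (s + (q - 1)) = q * codegreeDist q s := by
  have h : 0 < q - 1 := by omega
  simp only [codegreeDist, Nat.add_mod_right, Nat.add_div_right s h, pow_succ]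
  ring

lemma codegreeDist_zero {q : ℕ} (hq : 2 ≤ q) : codegreeDist q 0 = 1 :=
  codegreeDist_of_lt (by omega)

lemma codegreeDist_pos {q : ℕ} (hq : 2 ≤ q) (s : ℕ) : 0 < codegreeDist q s := by
  unfold codegreeDist
  positivity

lemma codegreeDist_strictMono {q : ℕ} (hq : 2 ≤ q) : StrictMono (codegreeDist q) := by
  refine strictMono_nat_of_lt_succ fun s => ?_
  induction s using Nat.strong_induction_on with
  | _ s ih =>
    rcases lt_or_ge s (q - 1) with h | h
    · rcases (show s + 1 < q - 1 ∨ s + 1 = q - 1 by omega) with h' | h'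
      · rw [codegreeDist_of_lt h, codegreeDist_of_lt h']
        omega
      · have := codegreeDist_add hq 0
        rw [codegreeDist_of_lt h, h']
        rw [codegreeDist_zero hq, zero_add] at this
        omega
    · obtain ⟨t, rfl⟩ := Nat.exists_eq_add_of_le' h
      rw [show t + (q - 1) + 1 = t + 1 + (q - 1) by ring, codegreeDist_add hq,
        codegreeDist_add hq]
      exact Nat.mul_lt_mul_of_pos_left (ih t (by omega)) (by omega)

/-- Increasing the codegree by `b ≤ q - 1` multiplies the distance by at most `b + 1`. This is
the arithmetic step in the induction for the minimum distance. -/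
lemma codegreeDist_add_le {q : ℕ} (hq : 2 ≤ q) {b : ℕ} (hb : b ≤ q - 1) (t : ℕ) :
    codegreeDist q (t + b) ≤ (b + 1) * codegreeDist q t := by
  induction t using Nat.strong_induction_on with
  | _ t ih =>
    rcases lt_or_ge t (q - 1) with h | h
    · rw [codegreeDist_of_lt h]
      rcases lt_or_ge (t + b) (q - 1) with h' | h'
      · rw [codegreeDist_of_lt h']
        nlinarith [Nat.zero_le (t * b)]
      · obtain ⟨r, hr⟩ := Nat.exists_eq_add_of_le' h'
        rw [hr, codegreeDist_add hq, codegreeDist_of_lt (by omega)]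
        obtain ⟨u, hu⟩ := Nat.exists_eq_add_of_le' (show t + 1 ≤ q by omega)
        obtain ⟨v, hv⟩ := Nat.exists_eq_add_of_le' (show b + 1 ≤ q by omega)
        -- with `u = q - (t + 1)` and `v = q - (b + 1)` the difference of the two sides is `u v`
        have h1 : r + 1 + u = b + 1 := by omega
        have h2 : q = u + (t + 1) := by omega
        have h3 : r + 1 + v = t + 1 := by omega
        rw [← h1, ← h3, h2, ← h3]
        nlinarith [Nat.zero_le (u * v)]
    · obtain ⟨r, rfl⟩ := Nat.exists_eq_add_of_le' h
      rw [show r + (q - 1) + b = r + b + (q - 1) by ring, codegreeDist_add hq,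
        codegreeDist_add hq, mul_left_comm]
      exact Nat.mul_le_mul_left _ (ih r (by omega))

/-- The value `(R + 1) q ^ Q` is attained as a product `∏ (b i + 1)` with `b i ≤ q - 1` and
`∑ b i = s`. -/
lemma exists_prod_eq_codegreeDist {q : ℕ} (hq : 2 ≤ q) :
    ∀ (m s : ℕ), s ≤ m * (q - 1) → ∃ b : Fin m → ℕ, (∀ i, b i ≤ q - 1) ∧ ∑ i, b i = s ∧
      ∏ i, (b i + 1) = codegreeDist q s
  | 0, s, hs => by
    obtain rfl : s = 0 := by simpa using hs
    exact ⟨fun _ => 0, by simp, by simp, by simp [codegreeDist_zero hq]⟩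
  | m + 1, s, hs => by
    rcases lt_or_ge s (q - 1) with h | h
    · refine ⟨Fin.cons s fun _ => 0, fun i => ?_, by simp [Fin.sum_univ_succ],
        by simp [Fin.prod_univ_succ, codegreeDist_of_lt h]⟩
      refine Fin.cases ?_ (fun i => ?_) i <;> simp [h.le]
    · obtain ⟨t, rfl⟩ := Nat.exists_eq_add_of_le' h
      obtain ⟨b, hb, hs, hp⟩ := exists_prod_eq_codegreeDist hq m t (by
        rw [add_mul, one_mul] at hs; omega)
      refine ⟨Fin.cons (q - 1) b, fun i => ?_, by simp [Fin.sum_univ_succ, hs, add_comm], ?_⟩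
      · refine Fin.cases ?_ (fun i => ?_) i <;> simp [hb]
      · simp only [Fin.prod_univ_succ, Fin.cons_zero, Fin.cons_succ, hp, codegreeDist_add hq]
        rw [Nat.sub_add_cancel (by omega)]

/-! ### Zeros of reduced polynomials -/

section

variable {F : Type*} [Field F] [Fintype F] [DecidableEq F]

lemma card_sub_natDegree_le (f : Polynomial F) (hf : f ≠ 0) :
    Fintype.card F - f.natDegree ≤ (Finset.univ.filter fun x => f.eval x ≠ 0).card := by
  have h : (Finset.univ.filter fun x => f.eval x = 0).card ≤ f.natDegree := by
    refine le_trans (Finset.card_le_card (t := f.roots.toFinset) fun x hx => ?_)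
      ((Multiset.toFinset_card_le _).trans f.card_roots')
    simpa [hf] using hx
  have := Finset.card_filter_add_card_filter_not (s := (Finset.univ : Finset F))
    (fun x => f.eval x = 0)
  rw [Finset.card_univ] at this
  simp only [ne_eq]
  omega

open MvPolynomial in
/-- A nonzero polynomial of total degree at most `ν` and of degree at most `q - 1` in each
variable does not vanish in at least `d(ν)` points. The proof is by induction on the number of
variables: if `g x₀ ^ a` is the leading term in the variable `x₀`, then over each point where
`g` does not vanish there are at least `q - a` points where the polynomial does not vanish. -/
theorem codegreeDist_le_card_eval_ne_zero {m : ℕ} (f : MvPolynomial (Fin m) F) (hf : f ≠ 0)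
    (hdeg : f ∈ restrictDegree (Fin m) F (Fintype.card F - 1)) {ν : ℕ} (hν : f.totalDegree ≤ ν) :
    codegreeDist (Fintype.card F) (m * (Fintype.card F - 1) - ν) ≤
      (Finset.univ.filter fun x => eval x f ≠ 0).card := by
  have hq : 2 ≤ Fintype.card F := Fintype.one_lt_card
  rw [mem_restrictDegree] at hdeg
  induction m generalizing ν with
  | zero =>
    rw [zero_mul, Nat.zero_sub, codegreeDist_zero hq]
    rw [Nat.one_le_iff_ne_zero, ← Nat.pos_iff_ne_zero, Finset.card_pos]
    obtain ⟨c, rfl⟩ := C_surjective (Fin 0) f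
    exact ⟨Fin.elim0, by
      rw [Finset.mem_filter]
      exact ⟨Finset.mem_univ _, by simpa using hf⟩⟩
  | succ m ih =>
    have hdeg' : ∀ i, degreeOf i f ≤ Fintype.card F - 1 := fun i => degreeOf_le_iff.2 fun s hs =>
      hdeg s hs i
    set G := finSuccEquiv F m f with hG
    have hG0 : G ≠ 0 := by simpa [hG] using hf
    set a := G.natDegree with ha
    have haq : a ≤ Fintype.card F - 1 := by
      rw [ha, hG, natDegree_finSuccEquiv]; exact hdeg' 0
    set g := G.coeff a with hg
    have hg0 : g ≠ 0 := by rw [hg]; exact Polynomial.leadingCoeff_ne_zero.2 hG0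
    have hgdeg : g.totalDegree + a ≤ f.totalDegree :=
      totalDegree_coeff_finSuccEquiv_add_le f a hg0
    have key := ih g hg0 (fun s hs i => degreeOf_le_iff.1
      ((degreeOf_coeff_finSuccEquiv f i a).trans (hdeg' _)) s hs)
      (show g.totalDegree ≤ ν - a by omega)
    have hfib : ∀ y : Fin m → F, eval y g ≠ 0 → Fintype.card F - a ≤
        (Finset.univ.filter fun t : F => eval (Fin.cons t y : Fin (m + 1) → F) f ≠ 0).card := by
      intro y hy
      have h1 : (G.map (eval y)).coeff a ≠ 0 := by rwa [Polynomial.coeff_map]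
      have h2 : (G.map (eval y)).natDegree ≤ a := Polynomial.natDegree_map_le
      have h3 := card_sub_natDegree_le (G.map (eval y)) (fun h => h1 (by rw [h]; simp))
      simp only [eval_eq_eval_mv_eval']
      exact (Nat.sub_le_sub_left h2 _).trans h3
    have hcount : (Finset.univ.filter fun x : Fin (m + 1) → F => eval x f ≠ 0).card =
        ∑ y : Fin m → F, (Finset.univ.filter fun t : F =>
          eval (Fin.cons t y : Fin (m + 1) → F) f ≠ 0).card := by
      simp only [Finset.card_filter]
      rw [← (Fin.consEquiv fun _ => F).sum_comp, Fintype.sum_prod_type, Finset.sum_comm]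
      rfl
    calc codegreeDist (Fintype.card F) ((m + 1) * (Fintype.card F - 1) - ν)
        ≤ codegreeDist (Fintype.card F) (m * (Fintype.card F - 1) - (ν - a) +
            (Fintype.card F - 1 - a)) := by
          refine (codegreeDist_strictMono hq).monotone ?_
          rw [add_mul, one_mul]
          omega
      _ ≤ (Fintype.card F - 1 - a + 1) * codegreeDist (Fintype.card F)
            (m * (Fintype.card F - 1) - (ν - a)) := codegreeDist_add_le hq (by omega) _
      _ ≤ (Fintype.card F - a) * (Finset.univ.filter fun y => eval y g ≠ 0).card := by
          rw [show Fintype.card F - 1 - a + 1 = Fintype.card F - a by omega]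
          exact Nat.mul_le_mul_left _ key
      _ = ∑ y ∈ Finset.univ.filter (fun y => eval y g ≠ 0), (Fintype.card F - a) := by
          rw [Finset.sum_const, smul_eq_mul, mul_comm]
      _ ≤ ∑ y ∈ Finset.univ.filter (fun y => eval y g ≠ 0), (Finset.univ.filter fun t : F =>
          eval (Fin.cons t y : Fin (m + 1) → F) f ≠ 0).card :=
          Finset.sum_le_sum fun y hy => hfib y (by simpa using hy)
      _ ≤ _ := by
          rw [hcount]
          exact Finset.sum_le_sum_of_subset (Finset.filter_subset _ _)

open MvPolynomial in
/-- A product of univariate polynomials `∏ (xᵢ - β)` attains the bound `d(ν)`. -/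
theorem exists_card_eval_ne_zero_eq_codegreeDist {m ν : ℕ} (hν : ν ≤ m * (Fintype.card F - 1)) :
    ∃ f : MvPolynomial (Fin m) F, f.totalDegree ≤ ν ∧
      (Finset.univ.filter fun x => eval x f ≠ 0).card =
        codegreeDist (Fintype.card F) (m * (Fintype.card F - 1) - ν) := by
  have hq : 2 ≤ Fintype.card F := Fintype.one_lt_card
  obtain ⟨b, hb, hs, hp⟩ := exists_prod_eq_codegreeDist hq m
    (m * (Fintype.card F - 1) - ν) (Nat.sub_le _ _)
  have hB : ∀ i, ∃ B : Finset F, B.card = b i + 1 := fun i => by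
    obtain ⟨B, -, hB⟩ := Finset.exists_subset_card_eq (s := (Finset.univ : Finset F))
      (n := b i + 1) (by rw [Finset.card_univ]; have := hb i; omega)
    exact ⟨B, hB⟩
  choose B hB using hB
  -- the polynomial is nonzero exactly on the box `∏ B i`
  refine ⟨∏ i, ∏ β ∈ (B i)ᶜ, (X i - C β), ?_, ?_⟩
  · calc _ ≤ ∑ i, ∑ β ∈ (B i)ᶜ, (X i - C β : MvPolynomial (Fin m) F).totalDegree :=
          (totalDegree_finsetProd _ _).trans
            (Finset.sum_le_sum fun i _ => totalDegree_finsetProd _ _)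
      _ ≤ ∑ i, ∑ β ∈ (B i)ᶜ, 1 := by
          refine Finset.sum_le_sum fun i _ => Finset.sum_le_sum fun β _ => ?_
          refine (totalDegree_sub_C_le _ _).trans ?_
          simp
      _ = ∑ i, (Fintype.card F - 1 - b i) := by
          refine Finset.sum_congr rfl fun i _ => ?_
          rw [Finset.sum_const, smul_eq_mul, mul_one, Finset.card_compl, hB]
          omega
      _ ≤ ν := by
          have h : ∑ i, (Fintype.card F - 1 - b i) + ∑ i, b i = m * (Fintype.card F - 1) := by
            rw [← Finset.sum_add_distrib, Finset.sum_congr rfl fun i _ =>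
              Nat.sub_add_cancel (hb i)]
            simp
          omega
  · rw [← hp, Finset.prod_congr rfl fun i _ => (hB i).symm, ← Fintype.card_piFinset]
    congr 1
    ext x
    simp only [Finset.mem_filter, Finset.mem_univ, true_and, map_prod, map_sub, eval_X, eval_C,
      Finset.prod_ne_zero_iff, Fintype.mem_piFinset, Finset.mem_compl, sub_ne_zero,
      forall_const]
    exact ⟨fun h i => by_contra fun hi => h i _ hi rfl,
      fun h i β hβ hx => hβ (hx ▸ h i)⟩

end

/-! ### Reduced exponents and their number -/

/-- The exponent vectors with all entries less than `q` and with sum at most `ν`; they index the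
reduced monomials of degree at most `ν`. -/
def reducedExponents (q m ν : ℕ) : Finset (Fin m → ℕ) :=
  (Fintype.piFinset fun _ => Finset.range q).filter fun e => ∑ i, e i ≤ ν

lemma mem_reducedExponents {q m ν : ℕ} {e : Fin m → ℕ} :
    e ∈ reducedExponents q m ν ↔ (∀ i, e i < q) ∧ ∑ i, e i ≤ ν := by
  simp [reducedExponents]

/-- The involution `e ↦ q - 1 - e` exchanges the exponents of degree at most `ν` with those of
degree greater than `m (q - 1) - 1 - ν`. -/
lemma card_reducedExponents_add_card_dual {q m ν : ℕ} (hν : ν + 1 ≤ m * (q - 1)) :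
    (reducedExponents q m ν).card + (reducedExponents q m (dualOrder q m ν)).card = q ^ m := by
  have htot : (Fintype.piFinset fun _ : Fin m => Finset.range q).card = q ^ m := by simp
  have hsum : ∀ e : Fin m → ℕ, (∀ i, e i < q) →
      ∑ i, (q - 1 - e i) + ∑ i, e i = m * (q - 1) := by
    intro e he
    rw [← Finset.sum_add_distrib,
      Finset.sum_congr rfl fun i _ => Nat.sub_add_cancel (Nat.le_sub_one_of_lt (he i))]
    simp
  rw [← htot, ← Finset.card_filter_add_card_filter_not (s := Fintype.piFinset _)
    (fun e : Fin m → ℕ => ∑ i, e i ≤ ν)]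
  refine congrArg₂ _ rfl ?_
  refine Finset.card_bij' (fun e _ i => q - 1 - e i) (fun e _ i => q - 1 - e i) ?_ ?_ ?_ ?_
  · intro e he
    rw [mem_reducedExponents, dualOrder] at he
    have := hsum e he.1
    simp only [Finset.mem_filter, Fintype.mem_piFinset, Finset.mem_range]
    exact ⟨fun i => by have := he.1 i; omega, by omega⟩
  · intro e he
    simp only [Finset.mem_filter, Fintype.mem_piFinset, Finset.mem_range] at he
    have := hsum e he.1
    rw [mem_reducedExponents, dualOrder]
    exact ⟨fun i => by have := he.1 i; omega, by omega⟩
  · intro e he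
    rw [mem_reducedExponents] at he
    funext i
    have := he.1 i
    dsimp only
    omega
  · intro e he
    simp only [Finset.mem_filter, Fintype.mem_piFinset, Finset.mem_range] at he
    funext i
    have := he.1 i
    dsimp only
    omega

open PowerSeries in
/-- The number of reduced monomials of degree at most `ν` is the coefficient of `X ^ ν` in
`(1 + X + ⋯ + X ^ (q - 1)) ^ m / (1 - X) = (1 - X ^ q) ^ m / (1 - X) ^ (m + 1)`, which is `k(ν)`. -/
theorem card_reducedExponents (q m ν : ℕ) :
    ((reducedExponents q m ν).card : ℤ) = grmDim q m ν := by
  have hleft : (∑ a ∈ Finset.range q, (X : ℤ⟦X⟧) ^ a) ^ m * mk 1 =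
      (1 - X ^ q) ^ m * (mk 1) ^ (m + 1) := by
    rw [← mul_neg_geom_sum, mul_pow, pow_succ, mul_assoc, mul_left_comm _ (_ ^ m), ← mul_assoc,
      ← mul_assoc, mul_assoc _ _ (mk 1 ^ m), ← mul_pow (1 - X), mul_comm (1 - X),
      mk_one_mul_one_sub_eq_one, one_pow, mul_one]
  have h1 : coeff ν ((∑ a ∈ Finset.range q, (X : ℤ⟦X⟧) ^ a) ^ m * mk 1) =
      ((reducedExponents q m ν).card : ℤ) := by
    have : (∑ a ∈ Finset.range q, (X : ℤ⟦X⟧) ^ a) ^ m =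
        ∑ e ∈ Fintype.piFinset fun _ : Fin m => Finset.range q, X ^ (∑ i, e i) := by
      rw [← Fin.prod_const, Finset.prod_univ_sum]
      simp only [Finset.prod_pow_eq_pow_sum]
    rw [this, Finset.sum_mul, map_sum]
    simp only [coeff_X_pow_mul', coeff_mk, Pi.one_apply]
    rw [reducedExponents, Finset.card_filter]
    push_cast
    rfl
  rw [← h1, hleft, sub_eq_neg_add, add_pow, Finset.sum_mul, map_sum, grmDim,
    mk_one_pow_eq_mk_choose_add]
  refine Finset.sum_congr rfl fun j _ => ?_
  have h2 : (-X ^ q : ℤ⟦X⟧) ^ j * 1 ^ (m - j) * (m.choose j : ℤ⟦X⟧) =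
      X ^ (j * q) * C ((-1) ^ j * (m.choose j : ℤ)) := by
    rw [neg_pow, one_pow, mul_one, ← pow_mul, mul_comm q j]
    simp only [map_mul, map_pow, map_neg, map_one, map_natCast]
    ring
  rw [h2, mul_assoc, coeff_X_pow_mul']
  refine if_congr Iff.rfl ?_ rfl
  rw [coeff_C_mul, coeff_mk, Nat.choose_symm_add]

/-! ### Generalized Reed-Muller codes -/

section

variable {F : Type*} [Field F]

lemma dualCode_anti {n : ℕ} {C D : Submodule F (Fin n → F)} (h : C ≤ D) :
    dualCode D ≤ dualCode C := fun _ hy x hx => hy x (h hx)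

lemma dualCode_eq_orthogonal {n : ℕ} (C : Submodule F (Fin n → F)) :
    dualCode C = LinearMap.BilinForm.orthogonal (dotProductBilin F F) C := rfl

lemma nondegenerate_dotProductBilin (n : ℕ) :
    LinearMap.BilinForm.Nondegenerate (dotProductBilin F F : LinearMap.BilinForm F (Fin n → F)) :=
  ⟨fun x h => dotProduct_eq_zero x h, fun x h => dotProduct_eq_zero x fun w => by
    rw [dotProduct_comm]; exact h w⟩

lemma finrank_dualCode {n : ℕ} (C : Submodule F (Fin n → F)) :
    Module.finrank F (dualCode C) = n - Module.finrank F C := by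
  rw [dualCode_eq_orthogonal,
    LinearMap.BilinForm.finrank_orthogonal (nondegenerate_dotProductBilin n)]
  simp

lemma dualCode_dualCode {n : ℕ} (C : Submodule F (Fin n → F)) :
    dualCode (dualCode C) = C := by
  rw [dualCode_eq_orthogonal, dualCode_eq_orthogonal]
  refine LinearMap.BilinForm.orthogonal_orthogonal (nondegenerate_dotProductBilin n) ?_ C
  intro x y h
  exact (dotProduct_comm y x).trans h

lemma evalPoints_apply {n m : ℕ} (P : Fin n → (Fin m → F)) (f : MvPolynomial (Fin m) F)
    (i : Fin n) : evalPoints P f i = MvPolynomial.eval (P i) f := rfl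

lemma mem_grmCode {n m ν : ℕ} {P : Fin n ≃ (Fin m → F)} {c : Fin n → F} :
    c ∈ grmCode P ν ↔ ∃ f : MvPolynomial (Fin m) F, f.totalDegree ≤ ν ∧ evalPoints P f = c := by
  simp [grmCode, MvPolynomial.mem_restrictTotalDegree]

lemma grmCode_mono {n m : ℕ} (P : Fin n ≃ (Fin m → F)) : Monotone (grmCode P) := by
  intro ν₁ ν₂ h c hc
  rw [mem_grmCode] at hc ⊢
  obtain ⟨f, hf, rfl⟩ := hc
  exact ⟨f, hf.trans h, rfl⟩

lemma hammingNorm_evalPoints [Fintype F] [DecidableEq F] {n m : ℕ} (P : Fin n ≃ (Fin m → F))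
    (f : MvPolynomial (Fin m) F) : hammingNorm (evalPoints P f) =
      (Finset.univ.filter fun x => MvPolynomial.eval x f ≠ 0).card := by
  unfold hammingNorm
  refine Finset.card_equiv P fun i => ?_
  rw [Finset.mem_filter_univ, Finset.mem_filter_univ, evalPoints_apply]

variable [Fintype F]

/-- Powers of the elements of `F` are powers with exponent less than `|F|`. -/
lemma exists_lt_card_pow_eq (k : ℕ) :
    ∃ r < Fintype.card F, r ≤ k ∧ ∀ x : F, x ^ k = x ^ r := by
  have hq : 2 ≤ Fintype.card F := Fintype.one_lt_card
  induction k using Nat.strong_induction_on with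
  | _ k ih =>
    rcases lt_or_ge k (Fintype.card F) with h | h
    · exact ⟨k, h, le_rfl, fun _ => rfl⟩
    · obtain ⟨t, rfl⟩ := Nat.exists_eq_add_of_le' h
      obtain ⟨r, hr, hrt, hx⟩ := ih (t + 1) (by omega)
      exact ⟨r, hr, by omega, fun x => by rw [pow_add, FiniteField.pow_card, ← pow_succ, hx]⟩

open MvPolynomial in
lemma exists_reduced_eval_eq {m ν : ℕ} (f : MvPolynomial (Fin m) F) (hf : f.totalDegree ≤ ν) :
    ∃ g ∈ restrictTotalDegree (Fin m) F ν ⊓ restrictDegree (Fin m) F (Fintype.card F - 1),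
      ∀ x, eval x f = eval x g := by
  choose r hr hrk hrx using exists_lt_card_pow_eq (F := F)
  refine ⟨∑ d ∈ f.support, monomial (Finsupp.equivFunOnFinite.symm fun i => r (d i)) (f.coeff d),
    Submodule.sum_mem _ fun d hd => ⟨?_, ?_⟩, fun x => ?_⟩
  · refine (monomial_mem_restrictSupport F).2 (Or.inl ?_)
    refine le_trans ?_ ((le_totalDegree hd).trans hf)
    rw [Finsupp.sum_fintype _ _ fun _ => rfl, Finsupp.sum_fintype _ _ fun _ => rfl]
    exact Finset.sum_le_sum fun i _ => hrk _
  · exact (monomial_mem_restrictSupport F).2 (Or.inl fun i => Nat.le_sub_one_of_lt (hr _))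
  · conv_lhs => rw [f.as_sum]
    simp only [map_sum, eval_monomial]
    refine Finset.sum_congr rfl fun d _ => ?_
    rw [Finsupp.prod_fintype _ _ fun _ => pow_zero _, Finsupp.prod_fintype _ _ fun _ => pow_zero _]
    simp [← hrx]

lemma grmCode_eq_map_reduced {n m : ℕ} (P : Fin n ≃ (Fin m → F)) (ν : ℕ) :
    grmCode P ν = (MvPolynomial.restrictTotalDegree (Fin m) F ν ⊓
      MvPolynomial.restrictDegree (Fin m) F (Fintype.card F - 1)).map (evalPoints P) := by
  refine le_antisymm (fun c hc => ?_) (Submodule.map_mono inf_le_left)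
  obtain ⟨f, hf, rfl⟩ := mem_grmCode.1 hc
  obtain ⟨g, hg, hfg⟩ := exists_reduced_eval_eq f hf
  exact ⟨g, hg, funext fun i => (hfg _).symm⟩

variable [DecidableEq F]

theorem isMinDistance_grmCode {n m : ℕ} (P : Fin n ≃ (Fin m → F)) {ν : ℕ}
    (hν : ν ≤ m * (Fintype.card F - 1)) :
    IsMinDistance (grmCode P ν) (grmDist (Fintype.card F) m ν) := by
  refine ⟨fun c hc hc0 => ?_, ?_⟩
  · rw [grmCode_eq_map_reduced] at hc
    obtain ⟨f, hf, rfl⟩ := hc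
    rw [hammingNorm_evalPoints]
    exact codegreeDist_le_card_eval_ne_zero f (fun h => hc0 (by rw [h, map_zero])) hf.2
      ((MvPolynomial.mem_restrictTotalDegree _ _ _).1 hf.1)
  · obtain ⟨f, hf, hcard⟩ := exists_card_eval_ne_zero_eq_codegreeDist hν
    rw [← hammingNorm_evalPoints P] at hcard
    refine ⟨evalPoints P f, mem_grmCode.2 ⟨f, hf, rfl⟩, fun h => ?_, hcard⟩
    rw [h, hammingNorm_zero] at hcard
    exact (codegreeDist_pos Fintype.one_lt_card _).ne hcard

/-- The distance `d(ν)` is strictly decreasing in `ν`, so that a word of minimum weight of the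
larger code is not in the smaller one. -/
theorem exists_mem_grmCode_notMem {n m : ℕ} (P : Fin n ≃ (Fin m → F)) {ν₁ ν₂ : ℕ} (h : ν₁ < ν₂)
    (hν : ν₂ ≤ m * (Fintype.card F - 1)) :
    ∃ c ∈ grmCode P ν₂, c ∉ grmCode P ν₁ ∧ hammingNorm c = grmDist (Fintype.card F) m ν₂ := by
  obtain ⟨c, hc, hc0, hcard⟩ := (isMinDistance_grmCode P hν).2
  refine ⟨c, hc, fun hc1 => ?_, hcard⟩
  have h1 := (isMinDistance_grmCode P (h.le.trans hν)).1 c hc1 hc0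
  have h2 : codegreeDist (Fintype.card F) (m * (Fintype.card F - 1) - ν₂) <
      codegreeDist (Fintype.card F) (m * (Fintype.card F - 1) - ν₁) :=
    codegreeDist_strictMono Fintype.one_lt_card (by omega)
  exact absurd (h1.trans hcard.le) (not_le.2 h2)

open MvPolynomial in
lemma finrank_grmCode_eq_card {n m : ℕ} (P : Fin n ≃ (Fin m → F)) (ν : ℕ) :
    Module.finrank F (grmCode P ν) = (reducedExponents (Fintype.card F) m ν).card := by
  have hq : 0 < Fintype.card F := Fintype.card_pos
  set V := restrictTotalDegree (Fin m) F ν ⊓ restrictDegree (Fin m) F (Fintype.card F - 1)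
    with hV
  have hinj : Function.Injective ((evalPoints P).domRestrict V) := by
    rw [← LinearMap.ker_eq_bot, LinearMap.ker_eq_bot']
    rintro ⟨f, hf⟩ hf0
    by_contra hne
    have h := codegreeDist_le_card_eval_ne_zero f (fun h => hne (Subtype.ext h)) hf.2 le_rfl
    rw [← hammingNorm_evalPoints P, show evalPoints P f = 0 from hf0, hammingNorm_zero] at h
    exact (codegreeDist_pos Fintype.one_lt_card _).not_ge h
  have hV' : V = restrictSupport F
      ({d | (d.sum fun _ e => e) ≤ ν} ∩ {d | ∀ i, d i ≤ Fintype.card F - 1}) := by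
    ext f
    simp only [hV, Submodule.mem_inf, restrictTotalDegree, restrictDegree,
      mem_restrictSupport_iff, Set.subset_inter_iff]
  rw [grmCode_eq_map_reduced, ← hV, ← LinearMap.range_domRestrict,
    LinearMap.finrank_range_of_inj hinj, hV',
    Module.finrank_eq_nat_card_basis (basisRestrictSupport F _),
    ← Nat.card_eq_finsetCard]
  refine Nat.card_congr (Finsupp.equivFunOnFinite.subtypeEquiv fun d => ?_)
  have hsum : (d.sum fun _ e => e) = ∑ i, d i := Finsupp.sum_fintype _ _ fun _ => rfl
  simp only [Set.mem_inter_iff, Set.mem_ofPred_eq, mem_reducedExponents, hsum,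
    Finsupp.equivFunOnFinite_apply, Nat.le_sub_one_iff_lt hq]
  exact and_comm

theorem finrank_grmCode {n m : ℕ} (P : Fin n ≃ (Fin m → F)) (ν : ℕ) :
    (Module.finrank F (grmCode P ν) : ℤ) = grmDim (Fintype.card F) m ν := by
  rw [finrank_grmCode_eq_card, card_reducedExponents]

open MvPolynomial in
theorem dualCode_grmCode {m ν : ℕ} (P : Fin (Fintype.card F ^ m) ≃ (Fin m → F))
    (hν : ν + 1 ≤ m * (Fintype.card F - 1)) :
    dualCode (grmCode P ν) = grmCode P (dualOrder (Fintype.card F) m ν) := by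
  symm
  refine Submodule.eq_of_le_of_finrank_eq (fun c hc b hb => ?_) ?_
  · obtain ⟨f, hf, rfl⟩ := mem_grmCode.1 hc
    obtain ⟨g, hg, rfl⟩ := mem_grmCode.1 hb
    have h := sum_eval_eq_zero (g * f) (by
      refine (totalDegree_mul _ _).trans_lt ?_
      rw [dualOrder] at hf
      rw [Fintype.card_fin, mul_comm]
      omega)
    rw [← h, ← P.sum_comp]
    simp [dotProduct, evalPoints_apply]
  · rw [finrank_dualCode, finrank_grmCode_eq_card, finrank_grmCode_eq_card,
      ← card_reducedExponents_add_card_dual hν, Nat.add_sub_cancel_left]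

end

/-! ### Error operators -/

section

variable {F : Type*} [Field F] [DecidableEq F] {n : ℕ}

lemma hammingNorm_le_errorWeight_left (a b : Fin n → F) : hammingNorm a ≤ errorWeight a b := by
  unfold hammingNorm errorWeight
  exact Finset.card_le_card (Finset.monotone_filter_right _ fun _ _ h => Or.inl h)

lemma hammingNorm_le_errorWeight_right (a b : Fin n → F) : hammingNorm b ≤ errorWeight a b := by
  unfold hammingNorm errorWeight
  exact Finset.card_le_card (Finset.monotone_filter_right _ fun _ _ h => Or.inr h)

lemma errorWeight_zero_right (a : Fin n → F) : errorWeight a 0 = hammingNorm a := by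
  simp [errorWeight, hammingNorm]

lemma errorWeight_zero_left (b : Fin n → F) : errorWeight 0 b = hammingNorm b := by
  simp [errorWeight, hammingNorm]

end

section

variable {F : Type*} [Field F] {n : ℕ} (p : ℕ) [Fact p.Prime] [Algebra (ZMod p) F]

/-- The additive character `x ↦ ω ^ tr(x)` of `F`. -/
noncomputable def traceChar (F : Type*) [Field F] (p : ℕ) [Fact p.Prime] [Algebra (ZMod p) F] :
    AddChar F ℂ :=
  ZMod.stdAddChar.compAddMonoidHom (Algebra.trace (ZMod p) F).toAddMonoidHom

lemma traceChar_apply (x : F) :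
    traceChar F p x = ZMod.stdAddChar (Algebra.trace (ZMod p) F x) := rfl

variable [Fintype F]

lemma exists_traceChar_mul_ne_one {x : F} (hx : x ≠ 0) : ∃ c : F, traceChar F p (c * x) ≠ 1 := by
  obtain ⟨t, ht⟩ := Algebra.trace_surjective (ZMod p) F 1
  refine ⟨t * x⁻¹, fun h => ?_⟩
  rw [inv_mul_cancel_right₀ hx, traceChar_apply, ht,
    ← AddChar.map_zero_eq_one (ZMod.stdAddChar (N := p))] at h
  exact one_ne_zero (ZMod.injective_stdAddChar h)

/-- The dual code may be computed with the trace character in place of the `F`-valued inner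
product, since a linear code is closed under scalars and the trace is nonzero. -/
lemma mem_dualCode_iff_traceChar {C : Submodule F (Fin n → F)} {y : Fin n → F} :
    y ∈ dualCode C ↔ ∀ x ∈ C, traceChar F p (x ⬝ᵥ y) = 1 := by
  refine ⟨fun h x hx => by rw [h x hx, AddChar.map_zero_eq_one], fun h x hx => ?_⟩
  by_contra hne
  obtain ⟨c, hc⟩ := exists_traceChar_mul_ne_one p hne
  exact hc (by rw [← smul_eq_mul, ← smul_dotProduct]; exact h _ (C.smul_mem c hx))

variable [DecidableEq F]

lemma opE_apply (a b y x : Fin n → F) :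
    opE p a b y x = if y = x + a then traceChar F p (b ⬝ᵥ x) else 0 := by
  simp only [opE, opX, opZ, mul_diagonal, of_apply, ite_mul, one_mul, zero_mul, traceChar_apply]

lemma opE_mulVec_apply (a b : Fin n → F) (v : (Fin n → F) → ℂ) (y : Fin n → F) :
    (opE p a b *ᵥ v) y = traceChar F p (b ⬝ᵥ (y - a)) * v (y - a) := by
  rw [mulVec, dotProduct, Finset.sum_eq_single (y - a)]
  · rw [opE_apply, if_pos (sub_add_cancel y a).symm]
  · intro x _ hx
    rw [opE_apply, if_neg (fun h => hx (by rw [h, add_sub_cancel_right])), zero_mul]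
  · simp

lemma opE_mul_opE (a b a' b' : Fin n → F) :
    opE p a b * opE p a' b' = traceChar F p (b ⬝ᵥ a') • opE p (a + a') (b + b') := by
  refine ext_of_mulVec_single fun i => ?_
  rw [← mulVec_mulVec, smul_mulVec]
  funext y
  rw [Pi.smul_apply, opE_mulVec_apply, opE_mulVec_apply, opE_mulVec_apply, smul_eq_mul,
    ← mul_assoc, ← mul_assoc, ← AddChar.map_add_eq_mul, ← AddChar.map_add_eq_mul,
    show y - (a + a') = y - a - a' by abel]
  congr 2
  rw [add_dotProduct]
  simp only [dotProduct_sub]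
  ring

lemma opE_zero_zero : opE p (0 : Fin n → F) 0 = 1 := by
  ext y x
  rw [opE_apply, add_zero, zero_dotProduct, AddChar.map_zero_eq_one, one_apply]

/-- An error operator is determined by its class up to scalars. -/
lemma opE_eq_smul_opE {a b a' b' : Fin n → F} {c : ℂ} (h : opE p a b = c • opE p a' b') :
    a = a' ∧ b = b' := by
  have h0 := congrFun (congrFun h a) 0
  rw [Matrix.smul_apply, opE_apply, opE_apply, if_pos (zero_add a).symm, zero_add, dotProduct_zero,
    dotProduct_zero, AddChar.map_zero_eq_one, smul_eq_mul] at h0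
  have ha : a = a' := by
    by_contra hne
    rw [if_neg hne, mul_zero] at h0
    exact one_ne_zero h0
  subst ha
  rw [if_pos rfl, mul_one] at h0
  refine ⟨rfl, ?_⟩
  have hmem : b - b' ∈ dualCode (⊤ : Submodule F (Fin n → F)) := by
    refine (mem_dualCode_iff_traceChar p).2 fun x _ => ?_
    have hx := congrFun (congrFun h (x + a)) x
    rw [Matrix.smul_apply, opE_apply, opE_apply, if_pos rfl, if_pos rfl, ← h0, one_smul] at hx
    rw [dotProduct_comm, sub_dotProduct, sub_eq_add_neg, AddChar.map_add_eq_mul, hx,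
      ← AddChar.map_add_eq_mul, add_neg_cancel, AddChar.map_zero_eq_one]
  refine sub_eq_zero.1 (dotProduct_eq_zero _ fun w => ?_)
  rw [dotProduct_comm]
  exact hmem w trivial

lemma exists_unit_eq_opE (a b : Fin n → F) :
    ∃ g : (Matrix (Fin n → F) (Fin n → F) ℂ)ˣ,
      (g : Matrix (Fin n → F) (Fin n → F) ℂ) = opE p a b := by
  have h1 : opE p a 0 * opE p (-a) 0 = 1 := by
    rw [opE_mul_opE, zero_dotProduct, AddChar.map_zero_eq_one, one_smul, add_neg_cancel, add_zero,
      opE_zero_zero]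
  have h2 : opE p 0 b * opE p 0 (-b) = 1 := by
    rw [opE_mul_opE, dotProduct_zero, AddChar.map_zero_eq_one, one_smul, add_neg_cancel, add_zero,
      opE_zero_zero]
  have h3 : opE p a b = opE p a 0 * opE p 0 b := by
    rw [opE_mul_opE, dotProduct_zero, AddChar.map_zero_eq_one, one_smul, zero_add, add_zero]
  exact ⟨Units.mkOfMulEqOne _ _ h1 * Units.mkOfMulEqOne _ _ h2, h3.symm⟩

end

/-! ### The CSS construction -/

section

variable {F : Type*} [Field F] {n : ℕ} {C₁ C₂ : Submodule F (Fin n → F)}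

/-- The CSS code: the functions on `F ^ n` that are supported on `C₂` and constant on the cosets
of `C₁`. -/
noncomputable def cssCode (C₁ C₂ : Submodule F (Fin n → F)) : Submodule ℂ ((Fin n → F) → ℂ) where
  carrier := {v | (∀ a ∈ C₁, ∀ x, v (x + a) = v x) ∧ ∀ x ∉ C₂, v x = 0}
  zero_mem' := ⟨fun _ _ _ => rfl, fun _ _ => rfl⟩
  add_mem' := fun {v w} hv hw => ⟨fun a ha x => by simp [hv.1 a ha, hw.1 a ha],
    fun x hx => by simp [hv.2 x hx, hw.2 x hx]⟩
  smul_mem' := fun c v hv => ⟨fun a ha x => by simp [hv.1 a ha], fun x hx => by simp [hv.2 x hx]⟩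

open Classical in
/-- Functions supported on `C₂` and constant on the cosets of `C₁` are functions on `C₂ / C₁`. -/
noncomputable def cssCodeEquiv (h : C₁ ≤ C₂) : cssCode C₁ C₂ ≃ₗ[ℂ] ((C₂ ⧸ C₁.submoduleOf C₂) → ℂ) where
  toFun v z := v.1 z.out.1
  map_add' _ _ := rfl
  map_smul' _ _ := rfl
  invFun w := ⟨fun x => if hx : x ∈ C₂ then w (Submodule.Quotient.mk ⟨x, hx⟩) else 0, by
    refine ⟨fun a ha x => ?_, fun x hx => dif_neg hx⟩
    by_cases hx : x ∈ C₂
    · simp only [dif_pos hx, dif_pos (C₂.add_mem hx (h ha))]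
      congr 1
      rw [Submodule.Quotient.eq, Submodule.submoduleOf, Submodule.mem_comap]
      simpa using ha
    · have hxa : x + a ∉ C₂ := fun hxa => hx ((C₂.add_mem_iff_left (h ha)).1 hxa)
      simp only [dif_neg hx, dif_neg hxa]⟩
  left_inv v := by
    ext x
    by_cases hx : x ∈ C₂
    · have hout : (Submodule.Quotient.mk (p := C₁.submoduleOf C₂) ⟨x, hx⟩).out.1 - x ∈ C₁ :=
        (Submodule.Quotient.eq (C₁.submoduleOf C₂)).1
          (Submodule.Quotient.mk_out (Submodule.Quotient.mk (p := C₁.submoduleOf C₂) ⟨x, hx⟩))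
      have := v.2.1 _ hout x
      rw [add_sub_cancel] at this
      simp only [dif_pos hx, this]
    · simp only [dif_neg hx, v.2.2 x hx]
  right_inv w := by
    funext z
    simp only [SetLike.coe_mem, dif_pos, Subtype.coe_eta]
    rw [Submodule.Quotient.mk_out]

lemma finrank_cssCode [Fintype F] (h : C₁ ≤ C₂) : Module.finrank ℂ (cssCode C₁ C₂) =
    Fintype.card F ^ (Module.finrank F C₂ - Module.finrank F C₁) := by
  have : Finite (C₂ ⧸ C₁.submoduleOf C₂) :=
    Finite.of_surjective _ (Submodule.mkQ_surjective (C₁.submoduleOf C₂))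
  have : Fintype (C₂ ⧸ C₁.submoduleOf C₂) := Fintype.ofFinite _
  rw [(cssCodeEquiv h).finrank_eq, Module.finrank_fintype_fun_eq_card,
    Module.card_eq_pow_finrank (K := F), Submodule.finrank_quotient,
    (Submodule.submoduleOfEquivOfLe h).finrank_eq]

open Classical in
/-- The indicator function of the coset `c + C₁`. -/
noncomputable def cosetIndicator (C₁ : Submodule F (Fin n → F)) (c : Fin n → F) : (Fin n → F) → ℂ :=
  fun x => if x - c ∈ C₁ then 1 else 0

lemma cosetIndicator_mem_cssCode (h : C₁ ≤ C₂) {c : Fin n → F} (hc : c ∈ C₂) :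
    cosetIndicator C₁ c ∈ cssCode C₁ C₂ := by
  refine ⟨fun a ha x => ?_, fun x hx => if_neg fun hxc => hx ?_⟩
  · have hx : x + a - c ∈ C₁ ↔ x - c ∈ C₁ := by
      rw [add_sub_right_comm, C₁.add_mem_iff_left ha]
    unfold cosetIndicator
    split_ifs <;> tauto
  · simpa using C₂.add_mem (h hxc) hc

lemma cosetIndicator_dotProduct_self_ne_zero [Fintype F] (c : Fin n → F) :
    star (cosetIndicator C₁ c) ⬝ᵥ cosetIndicator C₁ c ≠ 0 := by
  open ComplexOrder in
  rw [Ne, dotProduct_star_self_eq_zero]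
  intro h
  simpa [cosetIndicator] using congrFun h c

lemma cosetIndicator_dotProduct_eq_zero [Fintype F] {c d : Fin n → F} (h : c - d ∉ C₁) :
    star (cosetIndicator C₁ c) ⬝ᵥ cosetIndicator C₁ d = 0 := by
  refine Finset.sum_eq_zero fun x _ => ?_
  simp only [Pi.star_apply, cosetIndicator]
  by_cases hc : x - c ∈ C₁
  · rw [if_neg (c := x - d ∈ C₁) fun hd => h (by simpa using C₁.sub_mem hd hc), mul_zero]
  · rw [if_neg hc, star_zero, zero_mul]

end

section

variable {F : Type*} [Field F] [Fintype F] [DecidableEq F] {n : ℕ}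
variable (p : ℕ) [Fact p.Prime] [Algebra (ZMod p) F]

variable {C₁ C₂ : Submodule F (Fin n → F)}

/-- For `C₁ ⊆ C₂` the operators `X(a) Z(b)` with `a ∈ C₁` and `b ∈ C₂^⊥` commute and multiply
without phases, so that they already form the stabilizer group. -/
lemma mem_cssStabilizer (h : C₁ ≤ C₂) (g : (Matrix (Fin n → F) (Fin n → F) ℂ)ˣ) :
    g ∈ cssStabilizer p C₁ C₂ ↔ ∃ a ∈ C₁, ∃ b ∈ dualCode C₂,
      (g : Matrix (Fin n → F) (Fin n → F) ℂ) = opE p a b := by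
  refine ⟨fun hg => ?_, fun hg => Subgroup.subset_closure hg⟩
  have hmul : ∀ a ∈ C₁, ∀ b ∈ dualCode C₂, ∀ a' b' : Fin n → F,
      opE p a' b * opE p a b' = opE p (a' + a) (b + b') := by
    intro a ha b hb a' b'
    rw [opE_mul_opE, dotProduct_comm, hb a (h ha), AddChar.map_zero_eq_one, one_smul]
  refine Subgroup.closure_induction (fun x hx => hx) ?_ ?_ ?_ hg
  · exact ⟨0, C₁.zero_mem, 0, (dualCode C₂).zero_mem, (opE_zero_zero p).symm⟩
  · rintro x y - - ⟨a, ha, b, hb, hx⟩ ⟨a', ha', b', hb', hy⟩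
    refine ⟨a + a', C₁.add_mem ha ha', b + b', (dualCode C₂).add_mem hb hb', ?_⟩
    rw [Units.val_mul, hx, hy, hmul a' ha' b hb]
  · rintro x - ⟨a, ha, b, hb, hx⟩
    refine ⟨-a, C₁.neg_mem ha, -b, (dualCode C₂).neg_mem hb, ?_⟩
    rw [Units.inv_eq_of_mul_eq_one_right]
    rw [hx, hmul (-a) (C₁.neg_mem ha) b hb, add_neg_cancel, add_neg_cancel, opE_zero_zero]

lemma containsError_cssStabilizer (h : C₁ ≤ C₂) (a b : Fin n → F) :
    ContainsError p (cssStabilizer p C₁ C₂) a b ↔ a ∈ C₁ ∧ b ∈ dualCode C₂ := by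
  constructor
  · rintro ⟨g, hg, c, hc⟩
    obtain ⟨a', ha', b', hb', hg'⟩ := (mem_cssStabilizer p h g).1 hg
    obtain ⟨rfl, rfl⟩ := opE_eq_smul_opE p (hg'.symm.trans hc)
    exact ⟨ha', hb'⟩
  · rintro ⟨ha, hb⟩
    obtain ⟨g, hg⟩ := exists_unit_eq_opE p a b
    exact ⟨g, (mem_cssStabilizer p h g).2 ⟨a, ha, b, hb, hg⟩, 1, by rw [hg, one_smul]⟩

lemma mem_cssCode_iff_stabilized (h : C₁ ≤ C₂) (v : (Fin n → F) → ℂ) :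
    v ∈ cssCode C₁ C₂ ↔ ∀ g ∈ cssStabilizer p C₁ C₂,
      (g : Matrix (Fin n → F) (Fin n → F) ℂ) *ᵥ v = v := by
  constructor
  · rintro ⟨h1, h2⟩ g hg
    obtain ⟨a, ha, b, hb, hg⟩ := (mem_cssStabilizer p h g).1 hg
    funext y
    have hy : v (y - a) = v y := by rw [← h1 a ha, sub_add_cancel]
    rw [hg, opE_mulVec_apply, hy]
    by_cases hyC : y ∈ C₂
    · rw [dotProduct_comm, hb _ (C₂.sub_mem hyC (h ha)), AddChar.map_zero_eq_one, one_mul]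
    · rw [h2 y hyC, mul_zero]
  · intro hv
    have hE : ∀ a ∈ C₁, ∀ b ∈ dualCode C₂, opE p a b *ᵥ v = v := by
      intro a ha b hb
      obtain ⟨g, hg⟩ := exists_unit_eq_opE p a b
      rw [← hg]
      exact hv g ((mem_cssStabilizer p h g).2 ⟨a, ha, b, hb, hg⟩)
    refine ⟨fun a ha x => ?_, fun x hx => ?_⟩
    · have := congrFun (hE a ha 0 (dualCode C₂).zero_mem) (x + a)
      rwa [opE_mulVec_apply, zero_dotProduct, AddChar.map_zero_eq_one, one_mul,
        add_sub_cancel_right, eq_comm] at this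
    · rw [← dualCode_dualCode C₂, mem_dualCode_iff_traceChar p] at hx
      push Not at hx
      obtain ⟨b, hb, hbx⟩ := hx
      have := congrFun (hE 0 C₁.zero_mem b hb) x
      rw [opE_mulVec_apply, sub_zero] at this
      by_contra hvx
      exact hbx (mul_right_cancel₀ hvx (this.trans (one_mul _).symm))

lemma detects_of_notMem_left (a b : Fin n → F) (ha : a ∉ C₂) :
    Detects (cssCode C₁ C₂) (opE p a b) := by
  refine ⟨0, fun u hu v hv => ?_⟩
  rw [zero_mul]
  refine Finset.sum_eq_zero fun y _ => ?_
  rw [opE_mulVec_apply, Pi.star_apply]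
  by_cases hy : y ∈ C₂
  · rw [hv.2 (y - a) (fun hya => ha ((C₂.sub_mem_iff_right hy).1 hya)), mul_zero, mul_zero]
  · rw [hu.2 y hy, star_zero, zero_mul]

/-- Translation of the summation variable by an element of `C₁` multiplies `⟨u|Z(b)|v⟩` by a
nontrivial root of unity, so that it vanishes. -/
lemma detects_of_notMem_right (b : Fin n → F) (hb : b ∉ dualCode C₁) :
    Detects (cssCode C₁ C₂) (opE p 0 b) := by
  refine ⟨0, fun u hu v hv => ?_⟩
  rw [zero_mul]
  rw [mem_dualCode_iff_traceChar p] at hb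
  push Not at hb
  obtain ⟨c, hc, hcb⟩ := hb
  have h : star u ⬝ᵥ (opE p 0 b *ᵥ v) =
      traceChar F p (c ⬝ᵥ b) * (star u ⬝ᵥ (opE p 0 b *ᵥ v)) := by
    rw [dotProduct, Finset.mul_sum]
    refine (Equiv.sum_comp (Equiv.addRight c) _).symm.trans ?_
    refine Finset.sum_congr rfl fun y _ => ?_
    simp only [Equiv.coe_addRight, Pi.star_apply, opE_mulVec_apply, sub_zero, hu.1 c hc,
      hv.1 c hc, dotProduct_add, AddChar.map_add_eq_mul, dotProduct_comm c b]
    ring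
  by_contra hne
  exact hcb (mul_right_cancel₀ hne (h.symm.trans (one_mul _).symm))

lemma opE_zero_right_mulVec_cosetIndicator (a : Fin n → F) :
    opE p a 0 *ᵥ cosetIndicator C₁ 0 = cosetIndicator C₁ a := by
  funext y
  rw [opE_mulVec_apply, zero_dotProduct, AddChar.map_zero_eq_one, one_mul, cosetIndicator,
    cosetIndicator, sub_zero]

lemma opE_zero_left_mulVec_cosetIndicator {b : Fin n → F} (hb : b ∈ dualCode C₁)
    (d : Fin n → F) : opE p 0 b *ᵥ cosetIndicator C₁ d =
      traceChar F p (d ⬝ᵥ b) • cosetIndicator C₁ d := by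
  funext y
  rw [opE_mulVec_apply, Pi.smul_apply, smul_eq_mul, sub_zero]
  by_cases hy : y - d ∈ C₁
  · have h := hb _ hy
    rw [sub_dotProduct, sub_eq_zero] at h
    rw [dotProduct_comm, h]
  · rw [cosetIndicator, if_neg hy, mul_zero, mul_zero]

lemma not_detects_of_mem_left (h : C₁ ≤ C₂) {a : Fin n → F} (ha : a ∈ C₂) (ha' : a ∉ C₁) :
    ¬ Detects (cssCode C₁ C₂) (opE p a 0) := by
  rintro ⟨l, hl⟩
  have := hl _ (cosetIndicator_mem_cssCode h ha) _ (cosetIndicator_mem_cssCode h C₂.zero_mem)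
  rw [opE_zero_right_mulVec_cosetIndicator,
    cosetIndicator_dotProduct_eq_zero (d := 0) (by rwa [sub_zero]), mul_zero] at this
  exact cosetIndicator_dotProduct_self_ne_zero a this

lemma not_detects_of_mem_right (h : C₁ ≤ C₂) {b : Fin n → F} (hb : b ∈ dualCode C₁)
    (hb' : b ∉ dualCode C₂) : ¬ Detects (cssCode C₁ C₂) (opE p 0 b) := by
  rintro ⟨l, hl⟩
  rw [mem_dualCode_iff_traceChar p] at hb'
  push Not at hb'
  obtain ⟨c, hc, hcb⟩ := hb'
  have key : ∀ d ∈ C₂, traceChar F p (d ⬝ᵥ b) = l := by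
    intro d hd
    have := hl _ (cosetIndicator_mem_cssCode h hd) _ (cosetIndicator_mem_cssCode h hd)
    rw [opE_zero_left_mulVec_cosetIndicator p hb, dotProduct_smul, smul_eq_mul] at this
    exact mul_right_cancel₀ (cosetIndicator_dotProduct_self_ne_zero d) this
  refine hcb ((key c hc).trans ?_)
  rw [← key 0 C₂.zero_mem, zero_dotProduct, AddChar.map_zero_eq_one]

/-- The CSS construction: if `C₁ ⊆ C₂`, if `C₂` and `C₁^⊥` have minimum distances `d₂` and `d₁`
and if, for `C₁ ≠ C₂`, these are attained outside `C₁` and `C₂^⊥`, then the CSS code is pure of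
minimum distance `min d₁ d₂`. -/
theorem isPureStabilizerCode_cssCode (h : C₁ ≤ C₂) {d₁ d₂ : ℕ}
    (hd₁ : IsMinDistance (dualCode C₁) d₁) (hd₂ : IsMinDistance C₂ d₂)
    (hw₁ : C₁ ≠ C₂ → ∃ b ∈ dualCode C₁, b ∉ dualCode C₂ ∧ hammingNorm b = d₁)
    (hw₂ : C₁ ≠ C₂ → ∃ a ∈ C₂, a ∉ C₁ ∧ hammingNorm a = d₂) :
    IsPureStabilizerCode p (cssStabilizer p C₁ C₂) (cssCode C₁ C₂)
      (Module.finrank F C₂ - Module.finrank F C₁) (min d₁ d₂) := by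
  have hpure : IsPureTo p (cssStabilizer p C₁ C₂) (min d₁ d₂) := by
    intro a b h0 hlt hS
    obtain ⟨ha, hb⟩ := (containsError_cssStabilizer p h a b).1 hS
    have ha0 : a = 0 := by
      by_contra ha0
      have h1 := hd₂.1 a (h ha) ha0
      have h2 := hammingNorm_le_errorWeight_left a b
      omega
    have hb0 : b = 0 := by
      by_contra hb0
      have h1 := hd₁.1 b (dualCode_anti h hb) hb0
      have h2 := hammingNorm_le_errorWeight_right a b
      omega
    rw [ha0, hb0, errorWeight_zero_left, hammingNorm_zero] at h0
    exact h0.false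
  have hfin := finrank_cssCode h
  refine ⟨⟨?_, mem_cssCode_iff_stabilized p h, fun hbot => ?_⟩, hfin, ⟨fun h1 => ?_, fun h1 => ?_⟩,
    hpure⟩
  · refine Subgroup.closure_mono ?_
    rintro g ⟨a, -, b, -, hg⟩
    exact ⟨a, b, hg⟩
  · rw [hbot, finrank_bot] at hfin
    exact (pow_pos Fintype.card_pos _).ne hfin
  · refine ⟨fun a b hlt => ?_, ?_⟩
    · by_cases ha : a ∈ C₂
      · have ha0 : a = 0 := by
          by_contra ha0
          have h1 := hd₂.1 a ha ha0
          have h2 := hammingNorm_le_errorWeight_left a b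
          omega
        subst ha0
        by_cases hb : b ∈ dualCode C₁
        · have hb0 : b = 0 := by
            by_contra hb0
            have h1 := hd₁.1 b hb hb0
            have h2 := hammingNorm_le_errorWeight_right 0 b
            omega
          subst hb0
          exact ⟨1, fun u _ v _ => by rw [opE_zero_zero, one_mulVec, one_mul]⟩
        · exact detects_of_notMem_right p b hb
      · exact detects_of_notMem_left p a b ha
    · have hne : C₁ ≠ C₂ := by
        rintro rfl
        rw [hfin, Nat.sub_self, pow_zero] at h1
        exact h1.false
      rcases le_total d₁ d₂ with hd | hd
      · obtain ⟨b, hb, hb', hbd⟩ := hw₁ hne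
        exact ⟨0, b, by rw [errorWeight_zero_left, hbd, min_eq_left hd],
          not_detects_of_mem_right p h hb hb'⟩
      · obtain ⟨a, ha, ha', had⟩ := hw₂ hne
        exact ⟨a, 0, by rw [errorWeight_zero_right, had, min_eq_right hd],
          not_detects_of_mem_left p h ha ha'⟩
  · have heq : C₁ = C₂ := by
      rw [hfin] at h1
      refine Submodule.eq_of_le_of_finrank_le h ?_
      have := (Nat.pow_eq_one.1 h1).resolve_left Fintype.one_lt_card.ne'
      omega
    subst heq
    refine ⟨hpure, ?_⟩
    rcases le_total d₁ d₂ with hd | hd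
    · obtain ⟨b, hb, hb0, hbd⟩ := hd₁.2
      refine ⟨0, b, ?_, ?_, (containsError_cssStabilizer p h 0 b).2 ⟨C₁.zero_mem, hb⟩⟩
      · rw [errorWeight_zero_left]
        exact hammingNorm_pos_iff.2 hb0
      · rw [errorWeight_zero_left, hbd, min_eq_left hd]
    · obtain ⟨a, ha, ha0, had⟩ := hd₂.2
      refine ⟨a, 0, ?_, ?_, (containsError_cssStabilizer p h a 0).2
        ⟨ha, (dualCode C₁).zero_mem⟩⟩
      · rw [errorWeight_zero_right]
        exact hammingNorm_pos_iff.2 ha0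
      · rw [errorWeight_zero_right, had, min_eq_right hd]

end

theorem theorem1 {F : Type*} [Field F] [Fintype F] [DecidableEq F]
    (p : ℕ) [Fact p.Prime] [Algebra (ZMod p) F]
    (q : ℕ) (hq : Fintype.card F = q)
    (m ν₁ ν₂ : ℕ) (h₁₂ : ν₁ ≤ ν₂) (h₂ : ν₂ + 1 ≤ m * (q - 1))
    (P : Fin (q ^ m) ≃ (Fin m → F)) :
    grmCode P ν₁ ≤ grmCode P ν₂ ∧
    (Module.finrank F (grmCode P ν₁) : ℤ) = grmDim q m ν₁ ∧
    (Module.finrank F (grmCode P ν₂) : ℤ) = grmDim q m ν₂ ∧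
    IsMinDistance (grmCode P ν₂) (grmDist q m ν₂) ∧
    IsMinDistance (dualCode (grmCode P ν₁)) (grmDist q m (dualOrder q m ν₁)) ∧
    (ν₁ < ν₂ → ∃ c ∈ grmCode P ν₂, c ∉ grmCode P ν₁ ∧ hammingNorm c = grmDist q m ν₂) ∧
    ∃ (Q : Submodule ℂ ((Fin (q ^ m) → F) → ℂ)) (k : ℕ),
      (k : ℤ) = grmDim q m ν₂ - grmDim q m ν₁ ∧
      IsPureStabilizerCode p (cssStabilizer p (grmCode P ν₁) (grmCode P ν₂)) Q k
        (min (grmDist q m (dualOrder q m ν₁)) (grmDist q m ν₂)) := by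
  subst hq
  have hle := grmCode_mono P h₁₂
  have hd₂ := isMinDistance_grmCode P (ν := ν₂) (by omega)
  have hd₁ : IsMinDistance (dualCode (grmCode P ν₁))
      (grmDist (Fintype.card F) m (dualOrder (Fintype.card F) m ν₁)) := by
    rw [dualCode_grmCode P (by omega)]
    exact isMinDistance_grmCode P (by rw [dualOrder]; omega)
  have hw : ν₁ < ν₂ → _ := fun h => exists_mem_grmCode_notMem P h (by omega)
  have hlt : grmCode P ν₁ ≠ grmCode P ν₂ → ν₁ < ν₂ := fun hne =>
    lt_of_le_of_ne h₁₂ fun h => hne (by rw [h])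
  refine ⟨hle, finrank_grmCode P ν₁, finrank_grmCode P ν₂, hd₂, hd₁, hw, cssCode _ _, _, ?_,
    isPureStabilizerCode_cssCode p hle hd₁ hd₂ (fun hne => ?_) fun hne => hw (hlt hne)⟩
  · rw [Nat.cast_sub (Submodule.finrank_mono hle), finrank_grmCode, finrank_grmCode]
  · have := hlt hne
    rw [dualCode_grmCode P (ν := ν₁) (by omega), dualCode_grmCode P h₂]
    exact exists_mem_grmCode_notMem P (by rw [dualOrder, dualOrder]; omega)
      (by rw [dualOrder]; omega)
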